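/- **Setting.** Let $\mathcal I$ be a finite nonempty set of agents ($n=|\mathcal I|$), let each agent $i$ have a finite action set $\mathcal A_i$ with at least two elements (all $\mathcal A_i$ being subsets of a common set), let $\mathcal A=\prod_i\mathcal A_i$, and let $u_i:\mathcal A\to\mathbb R$ be the payoff functions. Say that $\alpha'\in\mathcal A$ is an $(i,j)$-swap of $\alpha\in\mathcal A$ if $\alpha'_i=\alpha_j$, $\alpha_i=\alpha'_j$, $\alpha'_k=\alpha_k$ for $k\ne i,j$, and $u_i(\alpha')=u_j(\alpha)$, $u_i(\alpha)=u_j(\alpha')$, $u_k(\alpha')=u_k(\alpha)$ for $k\neq i,j$. The game is *symmetric* if for all agents $i,j$ and all $\alpha\in\mathcal A$: (a) if $\alpha_i=\alpha_j$ then $u_i(\alpha)=u_j(\alpha)$; (b) if $\alpha_i\ne\alpha_j$ then some $\alpha'\in\mathcal A\setminus\{\alpha\}$ is an $(i,j)$-swap of $\alpha$. *Aspiration learning.* Fix constants $\zeta>0$, $0<\epsilon<2$, $c>0$, $0<h<1$ and $\underline\rho<\overline\rho$ with $\underline\rho<u_i(\alpha)<\overline\rho$ for all $i,\alpha$. Let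 $\mathcal X=\mathcal A\times[\underline\rho,\overline\rho]^n$, let $\mathtt{sat}$ be the nearest-point map $\mathbb R\to[\underline\rho,\overline\rho]$, and let $\phi(z)=1$ for $z\ge0$, $\phi(z)=\max(h,1+cz)$ for $z<0$. Given the state $(\alpha,\rho)$ and trembles $r\in\mathbb R^{n}$, the next aspiration levels are $\mathtt{sat}[\rho_i+\epsilon(u_i(\alpha)-\rho_i)+r_i]$ and, independently over the agents, agent $i$ keeps $\alpha_i$ with probability $\phi(u_i(\alpha)-\rho_i)$ and otherwise draws its next action uniformly from $\mathcal A_i\setminus\{\alpha_i\}$. Let $P$ be the transition kernel on $\mathcal X$ for $r=0$, and $Q$ the one in which exactly one agent, chosen uniformly, trembles, with $r_i$ uniform on $[-\zeta,\zeta]$ (and $r_j=0$ for $j\ne i$). Let $\mathcal S$ be the finite set of *pure strategy states*: the $(\alpha,\rho)\in\mathcal X$ with $\rho_i=u_i(\alpha)$ for all $i$. For $\delta>0$ let $N_\delta(s)$ be the open $\delta$-neighbourhood of $s$ in $\mathcal X$ ($\mathcal A$ discrete, sup-distance for $\rho$). Let $\hat P=[\hat P_{ss'}]_{s,s'\in\mathcal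 S}$ be given by $\hat P_{ss'}=\lim_{t\to\infty}(QP^t)(s,N_\delta(s'))$ for all sufficiently small $\delta>0$. For $s\neq s'$ in $\mathcal S$ with action profiles $\alpha,\alpha'$, write $s\sim s'$ if $\alpha'$ is an $(i,j)$-swap of $\alpha$ for some $i\ne j$. **Lemma 5.2.** For every symmetric game, $\hat P$ is well defined (the limits exist and do not depend on small $\delta$) and is a stochastic matrix with exactly one invariant probability vector $\pi=\pi\hat P$; and $\pi_s=\pi_{s'}$ for any $s,s'\in\mathcal S$ with $s\sim s'$. **Common-pool games (Lemma 5.3).** Suppose that $\mathcal A_i=\{p_0,\dots,p_{m-1}\}$ for all $i$, with $0\le p_0<\dots<p_{m-1}$, and that an agent $i$ playing $\alpha_i=p_j$ gets $1-c_j$ if $\alpha_i>\alpha_\ell$ for all $\ell\ne i$; gets $-c_j+\tau_j$ if instead some other agent $s$ satisfies $\alpha_s>\alpha_\ell$ for all $\ell\ne s$; and gets $-c_j$ otherwise. Here $0\le c_0<\dots<c_{m-1}<1$, $\tau_j>0$ for $j\le m-2$, and $-c_0<-c_{m-1}+\tau_{m-1}<\dots<-c_0+\tau_0<1-c_{m-1}$.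 Then likewise $\hat P$ is a well-defined stochastic matrix with a unique invariant probability vector $\pi$, and $\pi(\bar{\mathcal S}_i)=\pi(\bar{\mathcal S}_j)$ for all agents $i,j$, where $\bar{\mathcal S}_i$ is the set of $s\in\mathcal S$ whose action profile satisfies $\alpha_i>\alpha_\ell$ for all $\ell\neq i$. -/

import Mathlib

open MeasureTheory ProbabilityTheory Filter Topology
open scoped ENNReal Matrix

universe u v

noncomputable section

namespace AspirationLearning

/-- A finite strategic-form game with set of agents `ι`. The finite action sets `A i` are subsets
of one universe `U`, so that actions of different agents can be compared. Every agent has at least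
two actions, so that the rule "draw an action different from the current one" makes sense. -/
structure Game (ι : Type u) (U : Type v) where
  /-- the action set of each agent -/
  A : ι → Finset U
  two_le_card : ∀ i, 2 ≤ (A i).card
  /-- the payoff of each agent at each action profile -/
  u : ι → ((i : ι) → {a // a ∈ A i}) → ℝ

namespace Game

variable {ι : Type u} {U : Type v}

/-- Action profiles. -/
abbrev Profile (G : Game ι U) : Type (max u v) := (i : ι) → {a // a ∈ G.A i}

instance (G : Game ι U) [Finite ι] : Fintype G.Profile := Fintype.ofFinite _

instance (G : Game ι U) : DecidableEq G.Profile := Classical.decEq _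

instance (G : Game ι U) : MeasurableSpace G.Profile := ⊤

instance (G : Game ι U) : DiscreteMeasurableSpace G.Profile := ⟨fun _ => trivial⟩

/-- `α'` arises from `α` by swapping the actions of `i` and `j`, and correspondingly the payoffs. -/
def IsSwap (G : Game ι U) (i j : ι) (α α' : G.Profile) : Prop :=
  ((α' i : U) = α j ∧ (α i : U) = α' j ∧ ∀ k, k ≠ i → k ≠ j → α' k = α k) ∧
  (G.u i α' = G.u j α ∧ G.u i α = G.u j α' ∧ ∀ k, k ≠ i → k ≠ j → G.u k α' = G.u k α)

/-- Symmetric games. -/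
def IsSymmetric (G : Game ι U) : Prop :=
  ∀ (i j : ι) (α : G.Profile),
    ((α i : U) = α j → G.u i α = G.u j α) ∧
    ((α i : U) ≠ α j → ∃ α' : G.Profile, α' ≠ α ∧ G.IsSwap i j α α')

/-- Agent `i` succeeds at `α`: its action is strictly larger than that of any other agent. -/
def Succeeds (G : Game ι ℝ) (α : G.Profile) (i : ι) : Prop :=
  ∀ l, l ≠ i → (α l : ℝ) < α i

open Classical in
/-- Common-pool games. All agents have the actions `p 0 < p 1 < ⋯ < p m`; an agent that plays
`p j` gets `1 - c j` if it succeeds, `-c j + τ j` if another agent succeeds, and `-c j` if no agent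
succeeds. -/
def IsCommonPool (G : Game ι ℝ) : Prop :=
  ∃ (m : ℕ) (p c τ : Fin (m + 1) → ℝ),
    StrictMono p ∧ 0 ≤ p 0 ∧ (∀ i, G.A i = Finset.univ.image p) ∧
    StrictMono c ∧ 0 ≤ c 0 ∧ c (Fin.last m) < 1 ∧
    (∀ j, j ≠ Fin.last m → 0 < τ j) ∧
    -c 0 < -c (Fin.last m) + τ (Fin.last m) ∧
    StrictAnti (fun j => -c j + τ j) ∧
    -c 0 + τ 0 < 1 - c (Fin.last m) ∧
    ∀ (i : ι) (α : G.Profile) (j : Fin (m + 1)), (α i : ℝ) = p j →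
      G.u i α =
        if G.Succeeds α i then 1 - c j
        else if ∃ s, s ≠ i ∧ G.Succeeds α s then -c j + τ j
        else -c j

end Game

/-- The constants of the aspiration learning scheme for the game `G`. -/
structure Params {ι : Type u} {U : Type v} (G : Game ι U) where
  /-- size of the trembles -/
  ζ : ℝ
  /-- step size of the aspiration update -/
  ε : ℝ
  /-- slope of the response function -/
  c : ℝ
  /-- least probability of repeating an action -/
  h : ℝ
  /-- lower bound of the aspiration levels -/
  lo : ℝ
  /-- upper bound of the aspiration levels -/
  hi : ℝ
  ζ_pos : 0 < ζ
  ε_pos : 0 < ε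
  ε_lt_two : ε < 2
  c_pos : 0 < c
  h_pos : 0 < h
  h_lt_one : h < 1
  lo_lt_hi : lo < hi
  lo_lt : ∀ i α, lo < G.u i α
  lt_hi : ∀ i α, G.u i α < hi

namespace Params

variable {ι : Type u} {U : Type v} {G : Game ι U}

/-- The state space `𝒳 = 𝒜 × [lo, hi]^n` of pairs (action profile, aspiration levels), with its
Borel σ-algebra. -/
abbrev State (p : Params G) : Type (max u v) := G.Profile × (ι → Set.Icc p.lo p.hi)

/-- The saturation `sat` onto `[lo, hi]`. -/
def sat (p : Params G) (r : ℝ) : Set.Icc p.lo p.hi := Set.projIcc p.lo p.hi p.lo_lt_hi.le r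

/-- The response function `φ`. -/
def φ (p : Params G) (z : ℝ) : ℝ := if 0 ≤ z then 1 else max p.h (1 + p.c * z)

/-- The probability that agent `i` plays `b` next: it keeps its action with probability
`φ (u i α - ρ i)`, and otherwise draws uniformly from its other actions. -/
def actionProb (p : Params G) (x : p.State) (i : ι) (b : {a // a ∈ G.A i}) : ℝ :=
  open Classical in
  if b = x.1 i then p.φ (G.u i x.1 - x.2 i)
  else (1 - p.φ (G.u i x.1 - x.2 i)) / (((G.A i).card : ℝ) - 1)

/-- The aspiration levels after one step from `x` with trembles `r`. -/
def nextAspiration (p : Params G) (x : p.State) (r : ι → ℝ) : ι → Set.Icc p.lo p.hi :=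
  fun i => p.sat ((x.2 i : ℝ) + p.ε * (G.u i x.1 - x.2 i) + r i)

lemma measurable_sat (p : Params G) : Measurable p.sat :=
  (continuous_projIcc (h := p.lo_lt_hi.le)).measurable

lemma measurable_φ (p : Params G) : Measurable p.φ :=
  Measurable.ite measurableSet_Ici measurable_const (by fun_prop)

/-- Pure strategy states: every agent's aspiration level equals its payoff. -/
def PureState (p : Params G) : Type (max u v) :=
  {x : p.State // ∀ i, (x.2 i : ℝ) = G.u i x.1}

/-- The action profile of a pure strategy state. -/
def PureState.profile {p : Params G} (s : p.PureState) : G.Profile := s.1.1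

lemma PureState.profile_injective (p : Params G) :
    Function.Injective (PureState.profile : p.PureState → G.Profile) := by
  rintro ⟨⟨α, ρ⟩, hs⟩ ⟨⟨β, σ⟩, ht⟩ h
  obtain rfl : α = β := h
  have : ρ = σ := funext fun i => Subtype.ext ((hs i).trans (ht i).symm)
  subst this
  rfl

variable [Fintype ι]

/-- One step of the scheme, from the state `y.1` with the trembles `y.2`: the agents choose their
new actions independently. -/
def stepMeasure (p : Params G) (y : p.State × (ι → ℝ)) : Measure p.State :=
  ∑ α' : G.Profile, ENNReal.ofReal (∏ i, p.actionProb y.1 i (α' i)) •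
    Measure.dirac (α', p.nextAspiration y.1 y.2)

lemma measurable_stepMeasure (p : Params G) : Measurable p.stepMeasure := by
  classical
  refine Measure.measurable_of_measurable_coe _ fun s hs => ?_
  simp only [stepMeasure, Measure.coe_finsetSum, Measure.coe_smul, Finset.sum_apply,
    Pi.smul_apply, smul_eq_mul, Measure.dirac_apply' _ hs]
  refine Finset.measurable_sum _ fun α' _ => Measurable.mul ?_ ?_
  · refine ENNReal.measurable_ofReal.comp (Finset.measurable_prod _ fun i _ => ?_)
    have : Measurable fun x : p.State => p.actionProb x i (α' i) := by
      refine measurable_from_prod_countable_right fun α => ?_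
      unfold actionProb
      have hm : Measurable fun ρ : ι → Set.Icc p.lo p.hi => p.φ (G.u i α - ρ i) :=
        p.measurable_φ.comp (measurable_const.sub
          (measurable_subtype_coe.comp (measurable_pi_apply i)))
      by_cases h : α' i = α i
      · simpa [h] using hm
      · simpa [h] using (measurable_const.sub hm).div_const _
    exact this.comp measurable_fst
  · have hm : Measurable fun y : p.State × (ι → ℝ) => p.nextAspiration y.1 y.2 := by
      refine measurable_pi_lambda _ fun i => p.measurable_sat.comp ?_
      have h1 : Measurable fun y : p.State × (ι → ℝ) => ((y.1.2 i : ℝ)) :=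
        measurable_subtype_coe.comp
          ((measurable_pi_apply i).comp (measurable_snd.comp measurable_fst))
      have h2 : Measurable fun y : p.State × (ι → ℝ) => G.u i y.1.1 :=
        (measurable_of_countable (G.u i)).comp (measurable_fst.comp measurable_fst)
      exact (h1.add ((h2.sub h1).const_mul _)).add
        ((measurable_pi_apply i).comp measurable_snd)
    exact (measurable_one.indicator hs).comp (measurable_const.prodMk hm)

/-- One step of the scheme, given the trembles, as a kernel. -/
def stepKernel (p : Params G) : Kernel (p.State × (ι → ℝ)) p.State :=
  ⟨p.stepMeasure, p.measurable_stepMeasure⟩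

/-- The transition kernel of the scheme when the vector of trembles has law `ν` and is independent
of the current state. -/
def transition (p : Params G) (ν : Measure (ι → ℝ)) : Kernel p.State p.State :=
  p.stepKernel ∘ₖ (Kernel.id ×ₖ Kernel.const p.State ν)

/-- The unperturbed process: no agent trembles. -/
def P (p : Params G) : Kernel p.State p.State := p.transition (Measure.dirac 0)

/-- The law of the vector of trembles when exactly one agent trembles: the agent is uniform, and its
tremble is uniform on `[-ζ, ζ]`. -/
def singleTremble (p : Params G) : Measure (ι → ℝ) :=
  open Classical in
  (Fintype.card ι : ℝ≥0∞)⁻¹ • ∑ i : ι, (volume[|Set.Icc (-p.ζ) p.ζ]).map (Pi.single i)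

/-- The process in which exactly one agent trembles. -/
def Q (p : Params G) : Kernel p.State p.State := p.transition p.singleTremble

instance (p : Params G) : Finite p.PureState :=
  Finite.of_injective _ (PureState.profile_injective p)

instance (p : Params G) : Fintype p.PureState := Fintype.ofFinite _

instance (p : Params G) : DecidableEq p.PureState := Classical.decEq _

/-- Equivalence of pure strategy states. -/
def Equivalent (p : Params G) (s s' : p.PureState) : Prop :=
  s ≠ s' ∧ ∃ i j : ι, i ≠ j ∧ G.IsSwap i j s.profile s'.profile

/-- The open `δ`-neighbourhood of a state (profiles carry the discrete metric). -/
def nbhd (p : Params G) (δ : ℝ) (x : p.State) : Set p.State :=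
  {y | y.1 = x.1 ∧ ∀ i, |(y.2 i : ℝ) - x.2 i| < δ}

/-- `M` is the matrix `P̂`: for every sufficiently small `δ > 0`, its entry at `(s, s')` is the limit
of `(Q P ^ t) (s, N_δ(s'))` as `t → ∞`. (`(P ^ t) ∘ₖ Q` is first `Q`, then `t` steps of `P`.) -/
def IsLimitMatrix (p : Params G) (M : Matrix p.PureState p.PureState ℝ) : Prop :=
  ∀ s s' : p.PureState, ∀ᶠ δ in 𝓝[>] (0 : ℝ),
    Tendsto (fun t : ℕ => (((p.P ^ t) ∘ₖ p.Q) s.1).real (p.nbhd δ s'.1)) atTop (𝓝 (M s s'))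

/-- `π` is an invariant probability vector of the stochastic matrix `P̂` (in particular `P̂`, which is
unique as a limit, exists). -/
def IsInvariantDistribution (p : Params G) (π : p.PureState → ℝ) : Prop :=
  ∃ M : Matrix p.PureState p.PureState ℝ, p.IsLimitMatrix M ∧
    M ∈ Matrix.rowStochastic ℝ p.PureState ∧ π ∈ stdSimplex ℝ p.PureState ∧ π ᵥ* M = π

open Classical in
/-- The mass under `π` of the set of pure strategy states in which agent `i` succeeds. -/
def successMass {G : Game ι ℝ} (p : Params G) (π : p.PureState → ℝ) (i : ι) : ℝ :=
  ∑ s : p.PureState with G.Succeeds s.profile i, π s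

end Params

end AspirationLearning

/-!
A pure strategy state stays put under the unperturbed process `P`, so everything rests on where `P`
goes after a single tremble.

*Absorption.* If no agent changes its action, the aspiration levels approach the payoffs at the
geometric rate `|1 - ε| < 1`. As `φ z ≥ exp (-(c / h) |z|)`, the probability of never changing an
action from a state on is at least `stay`, the exponential of a negative multiple of the distance
between aspirations and payoffs, and hence is bounded away from zero. Consequently `P` is almost
surely absorbed in some action profile (`Params.sum_absorb`), with aspirations converging to its
payoffs, and the mass of `P ^ t` near a pure strategy state converges to the probability `absorb`
of absorption in its profile (`Params.tendsto_op_pow_indicator`). No measure on path space is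
needed: `stay`, restricted to a profile, is subharmonic for the transition operator, so its
iterates increase to `absorb`, and `1 - ∑ absorb` is a bounded harmonic function that a contraction
argument shows to vanish. Integrating over the trembles gives `P̂` as `Params.limitMatrix`.

*Uniqueness.* A positive tremble makes one agent dissatisfied and all others stay satisfied, so with
positive probability this agent switches to any prescribed action and the new profile is then kept
forever. Hence `P̂` is positive between profiles that differ in one action
(`Params.limitMatrix_pos`), thus irreducible, and it has exactly one invariant probability vector
(`existsUnique_invariant`). This holds for every game.

*Symmetry.* In a symmetric game exchanging two agents is an automorphism of the game. It commutes
with the transition operator and preserves the law of the trembles, so it leaves `P̂` invariant, and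
the unique invariant vector is fixed by it. Common-pool games are symmetric
(`Game.IsCommonPool.isSymmetric`), and exchanging `i` and `j` exchanges the states in which they
succeed.
-/

namespace AspirationLearning

/-! ### Invariant vectors of irreducible stochastic matrices -/

section Stochastic

variable {n : Type*} [Fintype n] [DecidableEq n] {M : Matrix n n ℝ}

lemma sum_vecMul_of_mem_rowStochastic (hM : M ∈ Matrix.rowStochastic ℝ n) (v : n → ℝ) :
    ∑ j, (v ᵥ* M) j = ∑ i, v i := by
  simp only [Matrix.vecMul, dotProduct]
  rw [Finset.sum_comm]
  simp only [← Finset.mul_sum, Matrix.sum_row_of_mem_rowStochastic hM, mul_one]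

/-- The absolute value of a left-invariant vector is invariant: `|v| ≤ |v| M` by the triangle
inequality, and both sides have the same total mass. -/
lemma abs_vecMul_eq_of_mem_rowStochastic (hM : M ∈ Matrix.rowStochastic ℝ n) {v : n → ℝ}
    (hv : v ᵥ* M = v) : (fun i => |v i|) ᵥ* M = fun i => |v i| := by
  have hle : ∀ j ∈ Finset.univ, |v j| ≤ ((fun i => |v i|) ᵥ* M) j := by
    intro j _
    conv_lhs => rw [← hv]
    simp only [Matrix.vecMul, dotProduct]
    refine (Finset.abs_sum_le_sum_abs _ _).trans_eq (Finset.sum_congr rfl fun i _ => ?_)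
    rw [abs_mul, abs_of_nonneg (hM.1 i j)]
  have := (Finset.sum_eq_sum_iff_of_le hle).1 (sum_vecMul_of_mem_rowStochastic hM _).symm
  exact funext fun j => (this j (Finset.mem_univ j)).symm

/-- If every nonempty set of states that is closed under the transitions of `M` is everything, then
a nonnegative invariant vector vanishes identically or nowhere. -/
lemma pos_of_vecMul_eq (hM : M ∈ Matrix.rowStochastic ℝ n)
    (hirr : ∀ S : Set n, S.Nonempty → (∀ s ∈ S, ∀ s', 0 < M s s' → s' ∈ S) → S = Set.univ)
    {v : n → ℝ} (hv : v ᵥ* M = v) (hv0 : ∀ i, 0 ≤ v i) {i : n} (hi : v i ≠ 0) (j : n) :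
    0 < v j := by
  suffices h : {i | 0 < v i} = Set.univ by
    have hj : j ∈ {i | 0 < v i} := by rw [h]; trivial
    exact hj
  · refine hirr _ ⟨i, (hv0 i).lt_of_ne' hi⟩ fun s hs s' hss' => ?_
    have : v s * M s s' ≤ (v ᵥ* M) s' :=
      Finset.single_le_sum (f := fun k => v k * M k s')
        (fun k _ => mul_nonneg (hv0 k) (hM.1 k s')) (Finset.mem_univ s)
    rw [hv] at this
    exact (mul_pos hs hss').trans_le this

/-- An irreducible stochastic matrix has exactly one invariant probability vector. Aperiodicity plays
no role: existence comes from the eigenvalue `1` and `abs_vecMul_eq_of_mem_rowStochastic`. -/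
theorem existsUnique_invariant [Nonempty n] (hM : M ∈ Matrix.rowStochastic ℝ n)
    (hirr : ∀ S : Set n, S.Nonempty → (∀ s ∈ S, ∀ s', 0 < M s s' → s' ∈ S) → S = Set.univ) :
    ∃! π : n → ℝ, π ∈ stdSimplex ℝ n ∧ π ᵥ* M = π := by
  obtain ⟨v, hv0, hv⟩ : ∃ v : n → ℝ, v ≠ 0 ∧ v ᵥ* (M - 1) = 0 := by
    -- `M - 1` kills the constant vector on the right, so it is singular.
    rw [Matrix.exists_vecMul_eq_zero_iff, ← Matrix.exists_mulVec_eq_zero_iff]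
    exact ⟨1, one_ne_zero, by rw [Matrix.sub_mulVec, hM.2, Matrix.one_mulVec, sub_self]⟩
  have hv : v ᵥ* M = v := by
    rw [Matrix.vecMul_sub, Matrix.vecMul_one] at hv
    exact sub_eq_zero.1 hv
  obtain ⟨i, hi⟩ := Function.ne_iff.1 hv0
  have hsum : 0 < ∑ i, |v i| :=
    Finset.sum_pos' (fun i _ => abs_nonneg _) ⟨i, Finset.mem_univ i, abs_pos.2 hi⟩
  refine ⟨(∑ i, |v i|)⁻¹ • fun i => |v i|, ⟨⟨fun j => ?_, ?_⟩, ?_⟩, ?_⟩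
  · exact mul_nonneg (inv_nonneg.2 hsum.le) (abs_nonneg _)
  · simp only [Pi.smul_apply, smul_eq_mul, ← Finset.mul_sum]
    exact inv_mul_cancel₀ hsum.ne'
  · rw [Matrix.smul_vecMul, abs_vecMul_eq_of_mem_rowStochastic hM hv]
  suffices huniq : ∀ π π' : n → ℝ, π ∈ stdSimplex ℝ n → π ᵥ* M = π → π' ∈ stdSimplex ℝ n →
      π' ᵥ* M = π' → π = π' by
    refine fun π' hπ' => huniq _ _ hπ'.1 hπ'.2 ⟨fun j => ?_, ?_⟩ ?_
    · exact mul_nonneg (inv_nonneg.2 hsum.le) (abs_nonneg _)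
    · simp only [Pi.smul_apply, smul_eq_mul, ← Finset.mul_sum]
      exact inv_mul_cancel₀ hsum.ne'
    · rw [Matrix.smul_vecMul, abs_vecMul_eq_of_mem_rowStochastic hM hv]
  intro π π' hπ hπM hπ' hπM'
  -- The difference `w` has total mass zero, so neither `|w| + w` nor `|w| - w` is positive
  -- everywhere unless the other one vanishes; both are invariant.
  set w := π - π' with hw
  have hwM : w ᵥ* M = w := by rw [hw, Matrix.sub_vecMul, hπM, hπM']
  have hwa := abs_vecMul_eq_of_mem_rowStochastic hM hwM
  have hw0 : ∑ i, w i = 0 := by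
    simp only [hw, Pi.sub_apply, Finset.sum_sub_distrib, hπ.2, hπ'.2, sub_self]
  suffices ∀ i, w i = 0 from funext fun i => sub_eq_zero.1 (this i)
  by_contra! hne
  obtain ⟨i, hi⟩ := hne
  have hp : (fun i => |w i| + w i) ᵥ* M = fun i => |w i| + w i := by
    change ((fun i => |w i|) + w) ᵥ* M = (fun i => |w i|) + w
    rw [Matrix.add_vecMul, hwa, hwM]
  have hm : (fun i => |w i| - w i) ᵥ* M = fun i => |w i| - w i := by
    change ((fun i => |w i|) - w) ᵥ* M = (fun i => |w i|) - w
    rw [Matrix.sub_vecMul, hwa, hwM]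
  have hp0 : ∀ i, 0 ≤ |w i| + w i := fun i => by linarith [neg_abs_le (w i)]
  have hm0 : ∀ i, 0 ≤ |w i| - w i := fun i => by linarith [le_abs_self (w i)]
  rcases lt_or_gt_of_ne hi with h | h
  · have hpos := pos_of_vecMul_eq hM hirr hm hm0 (i := i) (by rw [abs_of_neg h]; linarith)
    have : ∑ j, w j < 0 := Finset.sum_neg (fun j _ => by
      by_contra! hj
      have := hpos j
      rw [abs_of_nonneg hj, sub_self] at this
      exact this.false) ⟨i, Finset.mem_univ i⟩
    exact this.ne hw0
  · have hpos := pos_of_vecMul_eq hM hirr hp hp0 (i := i) (by rw [abs_of_pos h]; linarith)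
    have : 0 < ∑ j, w j := Finset.sum_pos (fun j _ => by
      by_contra! hj
      have := hpos j
      rw [abs_of_nonpos hj, neg_add_cancel] at this
      exact this.false) ⟨i, Finset.mem_univ i⟩
    exact this.ne' hw0

end Stochastic

namespace Params

variable {ι : Type u} {U : Type v} {G : Game ι U}

/-! ### Response probabilities and the deterministic aspiration update -/

lemma h_le_φ (p : Params G) (z : ℝ) : p.h ≤ p.φ z := by
  unfold φ
  split_ifs
  · exact p.h_lt_one.le
  · exact le_max_left _ _

lemma φ_le_one (p : Params G) (z : ℝ) : p.φ z ≤ 1 := by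
  unfold φ
  split_ifs with hz
  · exact le_rfl
  · have := mul_neg_of_pos_of_neg p.c_pos (not_le.1 hz)
    exact max_le p.h_lt_one.le (by linarith)

lemma φ_lt_one (p : Params G) {z : ℝ} (hz : z < 0) : p.φ z < 1 := by
  have := mul_neg_of_pos_of_neg p.c_pos hz
  rw [φ, if_neg hz.not_ge]
  exact max_lt p.h_lt_one (by linarith)

lemma φ_zero (p : Params G) : p.φ 0 = 1 := by simp [φ]

/-- The response function is bounded below by a decaying exponential, which makes infinite products
of its values along a geometrically decaying discrepancy bounded away from zero. -/
lemma exp_le_φ (p : Params G) (z : ℝ) : Real.exp (-(p.c / p.h * |z|)) ≤ p.φ z := by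
  have hφ : 0 < p.φ z := p.h_pos.trans_le (p.h_le_φ z)
  rw [← Real.le_log_iff_exp_le hφ]
  refine le_trans ?_ (Real.one_sub_inv_le_log_of_pos hφ)
  have h1 : 1 - p.φ z ≤ p.c * |z| := by
    unfold φ
    split_ifs with hz
    · rw [sub_self]
      exact mul_nonneg p.c_pos.le (abs_nonneg z)
    · rw [abs_of_neg (not_le.1 hz)]
      linarith [le_max_right p.h (1 + p.c * z)]
  have h2 : (p.φ z)⁻¹ - 1 = (1 - p.φ z) / p.φ z := by field_simp
  have h3 : (1 - p.φ z) / p.φ z ≤ p.c * |z| / p.h :=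
    div_le_div₀ (mul_nonneg p.c_pos.le (abs_nonneg z)) h1 p.h_pos (p.h_le_φ z)
  rw [div_mul_eq_mul_div]
  linarith

lemma actionProb_self (p : Params G) (x : p.State) (i : ι) :
    p.actionProb x i (x.1 i) = p.φ (G.u i x.1 - x.2 i) := by simp [actionProb]

lemma actionProb_of_ne (p : Params G) {x : p.State} {i : ι} {b : {a // a ∈ G.A i}}
    (hb : b ≠ x.1 i) : p.actionProb x i b =
      (1 - p.φ (G.u i x.1 - x.2 i)) / (((G.A i).card : ℝ) - 1) := by
  rw [actionProb, if_neg hb]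

lemma one_lt_card (G : Game ι U) (i : ι) : (1 : ℝ) < (G.A i).card := by
  exact_mod_cast G.two_le_card i

lemma actionProb_nonneg (p : Params G) (x : p.State) (i : ι) (b : {a // a ∈ G.A i}) :
    0 ≤ p.actionProb x i b := by
  unfold actionProb
  split_ifs
  · exact p.h_pos.le.trans (p.h_le_φ _)
  · exact div_nonneg (sub_nonneg.2 (p.φ_le_one _)) (sub_nonneg.2 (one_lt_card G i).le)

lemma sum_actionProb (p : Params G) (x : p.State) (i : ι) :
    ∑ b, p.actionProb x i b = 1 := by
  classical
  have hc : ((G.A i).card : ℝ) - 1 ≠ 0 := (sub_pos.2 (one_lt_card G i)).ne'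
  rw [← Finset.add_sum_erase _ _ (Finset.mem_univ (x.1 i)), actionProb_self]
  have : ∀ b ∈ Finset.univ.erase (x.1 i), p.actionProb x i b =
      (1 - p.φ (G.u i x.1 - x.2 i)) / (((G.A i).card : ℝ) - 1) := fun b hb =>
    p.actionProb_of_ne (Finset.ne_of_mem_erase hb)
  rw [Finset.sum_congr rfl this, Finset.sum_const, Finset.card_erase_of_mem (Finset.mem_univ _),
    Finset.card_univ, Fintype.card_coe, nsmul_eq_mul,
    Nat.cast_sub ((by norm_num : 1 ≤ 2).trans (G.two_le_card i)), Nat.cast_one,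
    mul_div_cancel₀ _ hc]
  ring

lemma abs_sat_sub_le (p : Params G) (i : ι) (α : G.Profile) (r : ℝ) :
    |(p.sat r : ℝ) - G.u i α| ≤ |r - G.u i α| := by
  have h : (p.sat (G.u i α) : ℝ) = G.u i α := by
    rw [sat, Set.projIcc_of_mem _ ⟨(p.lo_lt i α).le, (p.lt_hi i α).le⟩]
  conv_lhs => rw [← h]
  exact Set.abs_projIcc_sub_projIcc p.lo_lt_hi.le

/-- The state after one untrembled step in which every agent keeps its action. -/
def keep (p : Params G) (x : p.State) : p.State := (x.1, p.nextAspiration x 0)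

lemma keep_iterate_fst (p : Params G) (n : ℕ) (x : p.State) : (p.keep^[n] x).1 = x.1 := by
  induction n with
  | zero => rfl
  | succ n ih => rw [Function.iterate_succ_apply']; exact ih

lemma abs_keep_sub_le (p : Params G) (x : p.State) (i : ι) :
    |((p.keep x).2 i : ℝ) - G.u i x.1| ≤ |1 - p.ε| * |(x.2 i : ℝ) - G.u i x.1| := by
  refine (p.abs_sat_sub_le i x.1 _).trans_eq ?_
  rw [← abs_mul, Pi.zero_apply]
  congr 1
  ring

lemma abs_one_sub_ε_lt (p : Params G) : |1 - p.ε| < 1 :=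
  abs_lt.2 ⟨by linarith [p.ε_lt_two], by linarith [p.ε_pos]⟩

lemma stay_const_nonneg (p : Params G) : 0 ≤ p.c / p.h / (1 - |1 - p.ε|) :=
  div_nonneg (div_nonneg p.c_pos.le p.h_pos.le) (sub_nonneg.2 p.abs_one_sub_ε_lt.le)

variable [Fintype ι]

/-- The `ℓ¹`-discrepancy between aspiration levels and payoffs. -/
def gap (p : Params G) (x : p.State) : ℝ := ∑ i, |(x.2 i : ℝ) - G.u i x.1|

lemma gap_nonneg (p : Params G) (x : p.State) : 0 ≤ p.gap x :=
  Finset.sum_nonneg fun _ _ => abs_nonneg _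

lemma gap_keep_le (p : Params G) (x : p.State) : p.gap (p.keep x) ≤ |1 - p.ε| * p.gap x := by
  rw [gap, gap, Finset.mul_sum]
  exact Finset.sum_le_sum fun i _ => p.abs_keep_sub_le x i

lemma gap_keep_iterate_le (p : Params G) (n : ℕ) (x : p.State) :
    p.gap (p.keep^[n] x) ≤ |1 - p.ε| ^ n * p.gap x := by
  induction n with
  | zero => simp
  | succ n ih =>
    rw [Function.iterate_succ_apply', pow_succ', mul_assoc]
    exact (p.gap_keep_le _).trans (mul_le_mul_of_nonneg_left ih (abs_nonneg _))

lemma gap_le (p : Params G) (x : p.State) : p.gap x ≤ Fintype.card ι * (p.hi - p.lo) := by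
  refine (Finset.sum_le_card_nsmul _ _ (p.hi - p.lo) fun i _ => ?_).trans_eq
    (by rw [nsmul_eq_mul, Finset.card_univ])
  rw [abs_le]
  constructor <;> linarith [(x.2 i).2.1, (x.2 i).2.2, p.lo_lt i x.1, p.lt_hi i x.1]

/-- The discrepancy after `n` steps without a change of actions tends to zero uniformly in the
starting state. -/
lemma eventually_gap_keep_iterate_lt (p : Params G) {δ : ℝ} (hδ : 0 < δ) :
    ∀ᶠ n : ℕ in atTop, ∀ x : p.State, p.gap (p.keep^[n] x) < δ := by
  have h : Tendsto (fun n : ℕ => |1 - p.ε| ^ n * (Fintype.card ι * (p.hi - p.lo))) atTop (𝓝 0) := by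
    simpa using (tendsto_pow_atTop_nhds_zero_of_lt_one (abs_nonneg _)
      p.abs_one_sub_ε_lt).mul_const (Fintype.card ι * (p.hi - p.lo))
  filter_upwards [h.eventually_lt_const hδ] with n hn x
  exact ((p.gap_keep_iterate_le n x).trans
    (mul_le_mul_of_nonneg_left (p.gap_le x) (by positivity))).trans_lt hn

/-- A lower bound for the probability that, from `x` on, no agent ever changes its action. -/
def stay (p : Params G) (x : p.State) : ℝ :=
  Real.exp (-(p.c / p.h / (1 - |1 - p.ε|) * p.gap x))

/-- The probability that the next action profile is `α'`. -/
def stepProb (p : Params G) (x : p.State) (α' : G.Profile) : ℝ := ∏ i, p.actionProb x i (α' i)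

lemma stepProb_nonneg (p : Params G) (x : p.State) (α' : G.Profile) : 0 ≤ p.stepProb x α' :=
  Finset.prod_nonneg fun i _ => p.actionProb_nonneg x i _

lemma sum_stepProb (p : Params G) (x : p.State) : ∑ α', p.stepProb x α' = 1 := by
  classical
  have := Finset.prod_univ_sum (fun i => (Finset.univ : Finset {a // a ∈ G.A i}))
    (fun i b => p.actionProb x i b)
  simp only [sum_actionProb, Finset.prod_const_one] at this
  rw [this, Fintype.piFinset_univ]
  exact Finset.sum_congr (by ext; simp) fun _ _ => rfl

lemma stay_pos (p : Params G) (x : p.State) : 0 < p.stay x := Real.exp_pos _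

lemma stay_le_one (p : Params G) (x : p.State) : p.stay x ≤ 1 :=
  Real.exp_le_one_iff.2 (neg_nonpos.2 (mul_nonneg p.stay_const_nonneg (p.gap_nonneg x)))

lemma exists_le_stay (p : Params G) : ∃ κ > 0, ∀ x, κ ≤ p.stay x :=
  ⟨_, Real.exp_pos _, fun x => Real.exp_le_exp.2 (neg_le_neg
    (mul_le_mul_of_nonneg_left (p.gap_le x) p.stay_const_nonneg))⟩

/-- The defining property of `stay`: it is at most the probability of keeping all actions for one
step, times its value afterwards. -/
lemma stay_le (p : Params G) (x : p.State) :
    p.stay x ≤ p.stepProb x x.1 * p.stay (p.keep x) := by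
  have h1 : Real.exp (-(p.c / p.h * p.gap x)) ≤ p.stepProb x x.1 := by
    rw [gap, Finset.mul_sum, ← Finset.sum_neg_distrib, Real.exp_sum]
    refine Finset.prod_le_prod (fun i _ => (Real.exp_pos _).le) fun i _ => ?_
    rw [actionProb_self, abs_sub_comm]
    exact p.exp_le_φ _
  refine le_trans ?_ (mul_le_mul_of_nonneg_right h1 (p.stay_pos _).le)
  rw [stay, stay, ← Real.exp_add, Real.exp_le_exp]
  have hq : 0 < 1 - |1 - p.ε| := sub_pos.2 p.abs_one_sub_ε_lt
  have h2 := mul_le_mul_of_nonneg_left (p.gap_keep_le x) p.stay_const_nonneg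
  have h3 : p.c / p.h / (1 - |1 - p.ε|) * p.gap x =
      p.c / p.h * p.gap x + p.c / p.h / (1 - |1 - p.ε|) * (|1 - p.ε| * p.gap x) := by
    field_simp
    ring
  linarith

/-- A nonnegative function that loses at most the factor `stepProb x x.1` when no action changes for
one step loses at most the factor `stay x` over any number of such steps. -/
lemma stay_mul_le (p : Params G) {g : p.State → ℝ} (hg : ∀ x, 0 ≤ g x)
    (hstep : ∀ x, p.stepProb x x.1 * g (p.keep x) ≤ g x) (n : ℕ) (x : p.State) :
    p.stay x * g (p.keep^[n] x) ≤ g x := by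
  induction n generalizing x with
  | zero => exact mul_le_of_le_one_left (hg x) (p.stay_le_one x)
  | succ n ih =>
    rw [Function.iterate_succ_apply]
    refine le_trans ?_ (hstep x)
    refine le_trans (mul_le_mul_of_nonneg_right (p.stay_le x) (hg _)) ?_
    rw [mul_assoc]
    exact mul_le_mul_of_nonneg_left (ih _) (p.stepProb_nonneg _ _)

/-! ### The unperturbed transition operator and its absorption probabilities -/

/-- The transition operator of the unperturbed process on real functions of the state. As the
conditional law of the next state is finitely supported, it needs no measurability. -/
def op (p : Params G) : Module.End ℝ (p.State → ℝ) where
  toFun f x := ∑ α', p.stepProb x α' * f (α', p.nextAspiration x 0)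
  map_add' f g := funext fun _ => by simp [mul_add, Finset.sum_add_distrib]
  map_smul' a f := funext fun _ => by
    simp [Finset.mul_sum, mul_left_comm]

lemma op_apply (p : Params G) (f : p.State → ℝ) (x : p.State) :
    p.op f x = ∑ α', p.stepProb x α' * f (α', p.nextAspiration x 0) := rfl

lemma op_mono (p : Params G) : Monotone p.op := fun _ _ h _ =>
  Finset.sum_le_sum fun _ _ => mul_le_mul_of_nonneg_left (h _) (p.stepProb_nonneg _ _)

lemma op_pow_mono (p : Params G) (t : ℕ) : Monotone ⇑(p.op ^ t) := by
  rw [Module.End.coe_pow]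
  exact p.op_mono.iterate t

lemma op_one (p : Params G) : p.op 1 = 1 :=
  funext fun _ => by simp [op_apply, sum_stepProb]

lemma op_pow_one (p : Params G) (t : ℕ) : (p.op ^ t) 1 = 1 := by
  rw [Module.End.coe_pow]
  exact Function.iterate_fixed p.op_one t

lemma op_pow_nonneg (p : Params G) (t : ℕ) {f : p.State → ℝ} (hf : 0 ≤ f) :
    0 ≤ (p.op ^ t) f := by
  simpa using p.op_pow_mono t hf

lemma op_pow_le_one (p : Params G) (t : ℕ) {f : p.State → ℝ} (hf : f ≤ 1) :
    (p.op ^ t) f ≤ 1 := by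
  simpa [op_pow_one] using p.op_pow_mono t hf

lemma op_pow_indicator_nonneg (p : Params G) (t : ℕ) (B : Set p.State) (x : p.State) :
    0 ≤ (p.op ^ t) (B.indicator 1) x :=
  p.op_pow_nonneg t (Set.indicator_nonneg fun _ _ => zero_le_one) x

lemma op_pow_indicator_le_one (p : Params G) (t : ℕ) (B : Set p.State) (x : p.State) :
    (p.op ^ t) (B.indicator 1) x ≤ 1 :=
  p.op_pow_le_one t (Set.indicator_le_self' fun _ _ => zero_le_one) x

lemma stepProb_mul_le_op (p : Params G) {f : p.State → ℝ} (hf : 0 ≤ f) (x : p.State)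
    (α' : G.Profile) : p.stepProb x α' * f (α', p.nextAspiration x 0) ≤ p.op f x :=
  Finset.single_le_sum (f := fun α' => p.stepProb x α' * f (α', p.nextAspiration x 0))
    (fun _ _ => mul_nonneg (p.stepProb_nonneg _ _) (hf _)) (Finset.mem_univ α')

/-- The mean of `f` after `n` steps is at least the contribution of never changing an action. -/
lemma stay_mul_le_op_pow (p : Params G) {f : p.State → ℝ} (hf : 0 ≤ f) (n : ℕ) (x : p.State) :
    p.stay x * f (p.keep^[n] x) ≤ (p.op ^ n) f x := by
  induction n generalizing x with
  | zero => exact mul_le_of_le_one_left (hf x) (p.stay_le_one x)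
  | succ n ih =>
    rw [Function.iterate_succ_apply, pow_succ', Module.End.mul_apply]
    refine le_trans ?_ (p.stepProb_mul_le_op (p.op_pow_nonneg n hf) x x.1)
    refine le_trans (mul_le_mul_of_nonneg_right (p.stay_le x) (hf _)) ?_
    rw [mul_assoc]
    exact mul_le_mul_of_nonneg_left (ih _) (p.stepProb_nonneg _ _)

/-- The function `stay`, restricted to the states with action profile `α`. -/
def stayAt (p : Params G) (α : G.Profile) (x : p.State) : ℝ := if x.1 = α then p.stay x else 0

lemma stayAt_nonneg (p : Params G) (α : G.Profile) : 0 ≤ p.stayAt α := fun x => by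
  unfold stayAt
  split_ifs
  exacts [(p.stay_pos x).le, le_rfl]

lemma sum_stayAt (p : Params G) (x : p.State) : ∑ α, p.stayAt α x = p.stay x := by
  simp [stayAt]

lemma stayAt_le_one (p : Params G) (α : G.Profile) : p.stayAt α ≤ 1 := fun x => by
  unfold stayAt
  split_ifs
  exacts [p.stay_le_one x, zero_le_one]

lemma stayAt_le_op (p : Params G) (α : G.Profile) : p.stayAt α ≤ p.op (p.stayAt α) := fun x => by
  by_cases h : x.1 = α
  · refine le_trans ?_ (p.stepProb_mul_le_op (p.stayAt_nonneg α) x x.1)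
    have := p.stay_le x
    simpa [stayAt, h, keep] using this
  · rw [stayAt, if_neg h]
    simpa using p.op_mono (p.stayAt_nonneg α) x

lemma op_pow_stayAt_mono (p : Params G) (α : G.Profile) :
    Monotone fun t : ℕ => (p.op ^ t) (p.stayAt α) :=
  monotone_nat_of_le_succ fun t => by
    rw [pow_succ, Module.End.mul_apply]
    exact p.op_pow_mono t (p.stayAt_le_op α)

/-- The probability that the unperturbed process started at `x` is eventually absorbed in the action
profile `α`. -/
def absorb (p : Params G) (α : G.Profile) (x : p.State) : ℝ :=
  ⨆ t : ℕ, (p.op ^ t) (p.stayAt α) x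

lemma bddAbove_op_pow_stayAt (p : Params G) (α : G.Profile) (x : p.State) :
    BddAbove (Set.range fun t : ℕ => (p.op ^ t) (p.stayAt α) x) :=
  ⟨1, by rintro _ ⟨t, rfl⟩; exact p.op_pow_le_one t (p.stayAt_le_one α) x⟩

lemma op_pow_stayAt_le_absorb (p : Params G) (α : G.Profile) (x : p.State) (t : ℕ) :
    (p.op ^ t) (p.stayAt α) x ≤ p.absorb α x :=
  le_ciSup (p.bddAbove_op_pow_stayAt α x) t

lemma tendsto_op_pow_stayAt (p : Params G) (α : G.Profile) (x : p.State) :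
    Tendsto (fun t : ℕ => (p.op ^ t) (p.stayAt α) x) atTop (𝓝 (p.absorb α x)) :=
  tendsto_atTop_ciSup (fun _ _ h => p.op_pow_stayAt_mono α h x) (p.bddAbove_op_pow_stayAt α x)

lemma absorb_nonneg (p : Params G) (α : G.Profile) (x : p.State) : 0 ≤ p.absorb α x :=
  (p.stayAt_nonneg α x).trans (p.op_pow_stayAt_le_absorb α x 0)

/-- Absorption probabilities are harmonic for the unperturbed process. -/
lemma op_absorb (p : Params G) (α : G.Profile) : p.op (p.absorb α) = p.absorb α := funext fun x => by
  refine tendsto_nhds_unique ?_ ((tendsto_add_atTop_iff_nat 1).2 (p.tendsto_op_pow_stayAt α x))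
  simp only [pow_succ', Module.End.mul_apply, op_apply]
  exact tendsto_finsetSum _ fun α' _ => (p.tendsto_op_pow_stayAt α _).const_mul _

/-- The unperturbed process is absorbed almost surely. The probability `D` that it is not is
harmonic, and it is at most `1 - stay`, hence small after a long time without a change of actions,
which has probability at least `stay ≥ κ`; so `sup D ≤ (1 - κ) sup D`. -/
lemma sum_absorb (p : Params G) (x : p.State) : ∑ α, p.absorb α x = 1 := by
  obtain ⟨κ, hκ, hstay⟩ := p.exists_le_stay
  set D : p.State → ℝ := 1 - ∑ α, p.absorb α with hD
  have hDx : ∀ x, D x = 1 - ∑ α, p.absorb α x := fun x => by simp [hD]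
  have hop : p.op D = D := by simp [hD, op_one, op_absorb]
  have hD0 : ∀ x, 0 ≤ D x := fun x => by
    rw [hDx, sub_nonneg]
    refine le_of_tendsto (tendsto_finsetSum _ fun α _ => p.tendsto_op_pow_stayAt α x)
      (Eventually.of_forall fun t => ?_)
    rw [← Finset.sum_apply, ← map_sum]
    refine p.op_pow_le_one t (fun y => ?_) x
    rw [Finset.sum_apply, sum_stayAt]
    exact p.stay_le_one y
  have hDle : ∀ x, D x ≤ 1 - p.stay x := fun x => by
    rw [hDx, ← sum_stayAt]
    exact sub_le_sub_left (Finset.sum_le_sum fun α _ => p.op_pow_stayAt_le_absorb α x 0) _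
  have hbdd : BddAbove (Set.range D) :=
    ⟨1, by rintro _ ⟨y, rfl⟩; linarith [hDle y, p.stay_pos y]⟩
  set v := ⨆ y, D y with hv
  have hDv : ∀ y, D y ≤ v := le_ciSup hbdd
  have hv0 : 0 ≤ v := (hD0 x).trans (hDv x)
  have hg : ∀ (n : ℕ) (y : p.State), p.stay y * (v - D (p.keep^[n] y)) ≤ v - D y :=
    p.stay_mul_le (g := fun y => v - D y) (fun y => sub_nonneg.2 (hDv y)) fun y => by
      have h0 : (0 : p.State → ℝ) ≤ v • 1 - D := fun z => by simpa using hDv z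
      have := p.stepProb_mul_le_op h0 y y.1
      rw [map_sub, map_smul, op_one, hop] at this
      simpa [keep] using this
  have hlim : ∀ y, Tendsto (fun n : ℕ => D (p.keep^[n] y)) atTop (𝓝 0) := fun y => by
    have h1 : Tendsto (fun n : ℕ => p.gap (p.keep^[n] y)) atTop (𝓝 0) := by
      refine tendsto_order.2 ⟨fun a ha => Eventually.of_forall fun n => ha.trans_le
        (p.gap_nonneg _), fun a ha => ?_⟩
      exact (p.eventually_gap_keep_iterate_lt ha).mono fun n hn => hn y
    have h2 : Tendsto (fun n : ℕ => 1 - p.stay (p.keep^[n] y)) atTop (𝓝 0) := by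
      have := ((Real.continuous_exp.tendsto _).comp
        (h1.const_mul (p.c / p.h / (1 - |1 - p.ε|))).neg).const_sub 1
      simpa [stay, Function.comp_def] using this
    exact squeeze_zero (fun n => hD0 _) (fun n => hDle _) h2
  have hle : ∀ y, D y ≤ (1 - κ) * v := fun y => by
    have h1 : p.stay y * (v - 0) ≤ v - D y :=
      le_of_tendsto (((hlim y).const_sub v).const_mul (p.stay y))
        (Eventually.of_forall fun n => hg n y)
    have h2 := mul_le_mul_of_nonneg_right (hstay y) hv0
    linarith
  have : Nonempty p.State := ⟨x⟩
  have hvle : v ≤ (1 - κ) * v := ciSup_le hle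
  have : D x = 0 := le_antisymm ((hDv x).trans (by nlinarith)) (hD0 x)
  linarith [hDx x]

lemma absorb_le_one (p : Params G) (α : G.Profile) (x : p.State) : p.absorb α x ≤ 1 := by
  rw [← p.sum_absorb x]
  exact Finset.single_le_sum (f := fun α => p.absorb α x) (fun β _ => p.absorb_nonneg β x)
    (Finset.mem_univ α)

/-- A profile that is reached with positive probability in one step may be kept forever. -/
lemma absorb_pos (p : Params G) {α : G.Profile} {x : p.State} (h : 0 < p.stepProb x α) :
    0 < p.absorb α x := by
  refine lt_of_lt_of_le ?_ (p.op_pow_stayAt_le_absorb α x 1)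
  rw [pow_one]
  refine lt_of_lt_of_le (mul_pos h ?_) (p.stepProb_mul_le_op (p.stayAt_nonneg α) x α)
  rw [stayAt, if_pos rfl]
  exact p.stay_pos _

/-- The mass that `P ^ t` puts near a pure strategy state tends to the absorption probability. -/
lemma tendsto_op_pow_indicator (p : Params G) {δ : ℝ} (hδ : 0 < δ) (s : p.PureState)
    (x : p.State) :
    Tendsto (fun t : ℕ => (p.op ^ t) ((p.nbhd δ s.1).indicator 1) x) atTop
      (𝓝 (p.absorb s.profile x)) := by
  classical
  -- the neighbourhood of the pure strategy state with profile `α`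
  let N : G.Profile → Set p.State := fun α => {y | y.1 = α ∧ ∀ i, |(y.2 i : ℝ) - G.u i α| < δ}
  have hN : p.nbhd δ s.1 = N s.profile := by
    ext y
    simp only [nbhd, N, Set.mem_ofPred_eq, s.2, PureState.profile]
  rw [hN]
  generalize s.profile = α
  have hN0 : ∀ β, 0 ≤ (N β).indicator (1 : p.State → ℝ) := fun β =>
    Set.indicator_nonneg fun _ _ => zero_le_one
  obtain ⟨n, hn⟩ := (p.eventually_gap_keep_iterate_lt hδ).exists
  have hlow : ∀ β, p.stayAt β ≤ (p.op ^ n) ((N β).indicator 1) := fun β y => by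
    by_cases h : y.1 = β
    · refine le_trans ?_ (p.stay_mul_le_op_pow (hN0 β) n y)
      have hmem : p.keep^[n] y ∈ N β := by
        refine ⟨(p.keep_iterate_fst n y).trans h, fun i => lt_of_le_of_lt ?_ (hn y)⟩
        rw [gap, keep_iterate_fst, h]
        exact Finset.single_le_sum (f := fun i => |((p.keep^[n] y).2 i : ℝ) - G.u i β|)
          (fun _ _ => abs_nonneg _) (Finset.mem_univ i)
      simp [stayAt, h, hmem]
    · rw [stayAt, if_neg h]
      exact p.op_pow_nonneg n (hN0 β) y
  have hlow' : ∀ β (t : ℕ),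
      (p.op ^ t) (p.stayAt β) x ≤ (p.op ^ (t + n)) ((N β).indicator 1) x := fun β t => by
    rw [pow_add, Module.End.mul_apply]
    exact p.op_pow_mono t (hlow β) x
  rw [← tendsto_add_atTop_iff_nat n]
  refine tendsto_of_tendsto_of_tendsto_of_le_of_le (p.tendsto_op_pow_stayAt α x)
    (h := fun t => 1 - ∑ β ∈ Finset.univ.erase α, (p.op ^ t) (p.stayAt β) x) ?_
    (fun t => hlow' α t) fun t => ?_
  · have h1 : p.absorb α x = 1 - ∑ β ∈ Finset.univ.erase α, p.absorb β x := by
      rw [← p.sum_absorb x, ← Finset.add_sum_erase _ _ (Finset.mem_univ α)]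
      ring
    rw [h1]
    exact (tendsto_finsetSum _ fun β _ => p.tendsto_op_pow_stayAt β x).const_sub 1
  · -- the neighbourhoods of distinct pure strategy states are disjoint
    have h1 : ∑ β, (p.op ^ (t + n)) ((N β).indicator 1) x ≤ 1 := by
      rw [← Finset.sum_apply, ← map_sum]
      refine p.op_pow_le_one _ (fun y => ?_) x
      rw [Finset.sum_apply, Finset.sum_eq_single y.1]
      · exact Set.indicator_le_self' (fun _ _ => zero_le_one) y
      · exact fun β _ hβ => Set.indicator_of_notMem (fun h => hβ h.1.symm) _
      · exact fun h => absurd (Finset.mem_univ _) h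
    rw [← Finset.add_sum_erase _ _ (Finset.mem_univ α)] at h1
    have h2 := Finset.sum_le_sum fun β (_ : β ∈ Finset.univ.erase α) => hlow' β t
    change (p.op ^ (t + n)) ((N α).indicator 1) x ≤ _
    linarith

/-! ### The kernels `P` and `Q` as operators -/

lemma lintegral_stepMeasure (p : Params G) (y : p.State × (ι → ℝ)) {f : p.State → ℝ≥0∞}
    (hf : Measurable f) :
    ∫⁻ z, f z ∂p.stepMeasure y =
      ∑ α', ENNReal.ofReal (p.stepProb y.1 α') * f (α', p.nextAspiration y.1 y.2) := by
  simp only [stepMeasure, lintegral_finsetSum_measure, lintegral_smul_measure,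
    lintegral_dirac' _ hf, stepProb, smul_eq_mul]

lemma lintegral_transition (p : Params G) (ν : Measure (ι → ℝ)) [SFinite ν] (x : p.State)
    {f : p.State → ℝ≥0∞} (hf : Measurable f) :
    ∫⁻ z, f z ∂p.transition ν x = ∫⁻ r, ∫⁻ z, f z ∂p.stepMeasure (x, r) ∂ν := by
  rw [transition, Kernel.lintegral_comp _ _ _ hf,
    Kernel.lintegral_id_prod (Measurable.lintegral_kernel hf), Kernel.const_apply]
  rfl

lemma lintegral_P (p : Params G) (x : p.State) {f : p.State → ℝ≥0∞} (hf : Measurable f) :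
    ∫⁻ z, f z ∂p.P x =
      ∑ α', ENNReal.ofReal (p.stepProb x α') * f (α', p.nextAspiration x 0) := by
  have hm : Measurable fun r => ∫⁻ z, f z ∂p.stepMeasure (x, r) :=
    (Measurable.lintegral_kernel (κ := p.stepKernel) hf).comp measurable_prodMk_left
  rw [P, lintegral_transition p _ x hf, lintegral_dirac' _ hm, lintegral_stepMeasure p _ hf]

lemma P_pow_apply (p : Params G) (t : ℕ) (x : p.State) {B : Set p.State} (hB : MeasurableSet B) :
    (p.P ^ t) x B = ENNReal.ofReal ((p.op ^ t) (B.indicator 1) x) := by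
  induction t generalizing x with
  | zero =>
    rw [pow_zero, pow_zero]
    change Kernel.id x B = _
    rw [Kernel.id_apply, Measure.dirac_apply' _ hB]
    by_cases hx : x ∈ B <;> simp [hx]
  | succ t ih =>
    have hf := Kernel.measurable_coe (p.P ^ t) hB
    rw [add_comm t 1, Kernel.pow_add_apply_eq_lintegral _ _ _ _ hB, pow_one,
      lintegral_P p x hf, pow_add, pow_one, Module.End.mul_apply, op_apply,
      ENNReal.ofReal_sum_of_nonneg fun α' _ =>
        mul_nonneg (p.stepProb_nonneg _ _) (p.op_pow_indicator_nonneg t B _)]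
    exact Finset.sum_congr rfl fun α' _ => by
      rw [ENNReal.ofReal_mul (p.stepProb_nonneg _ _), ih]

lemma measurable_op_pow_indicator (p : Params G) (t : ℕ) {B : Set p.State}
    (hB : MeasurableSet B) : Measurable ((p.op ^ t) (B.indicator 1)) := by
  have h : (p.op ^ t) (B.indicator 1) = fun x => ((p.P ^ t) x B).toReal := funext fun x => by
    rw [P_pow_apply p t x hB, ENNReal.toReal_ofReal (p.op_pow_indicator_nonneg t B x)]
  rw [h]
  exact (Kernel.measurable_coe _ hB).ennreal_toReal

omit [Fintype ι] in
lemma measurableSet_nbhd [Countable ι] (p : Params G) (δ : ℝ) (x : p.State) :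
    MeasurableSet (p.nbhd δ x) := by
  have h : p.nbhd δ x = Prod.fst ⁻¹' {x.1} ∩ ⋂ i, {y : p.State | |(y.2 i : ℝ) - x.2 i| < δ} := by
    ext
    simp [nbhd]
  rw [h]
  refine (measurable_fst (measurableSet_singleton x.1)).inter
    (MeasurableSet.iInter fun i => measurableSet_lt ?_ measurable_const)
  have h2 : Measurable fun y : p.State => (y.2 i : ℝ) :=
    measurable_subtype_coe.comp ((measurable_pi_apply i).comp measurable_snd)
  exact (h2.sub measurable_const).abs

omit [Fintype ι] in
lemma profile_bijective (p : Params G) :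
    Function.Bijective (PureState.profile : p.PureState → G.Profile) :=
  ⟨PureState.profile_injective p, fun α => ⟨⟨(α, fun i => ⟨G.u i α, (p.lo_lt i α).le,
    (p.lt_hi i α).le⟩), fun _ => rfl⟩, rfl⟩⟩

lemma measurable_absorb (p : Params G) (α : G.Profile) : Measurable (p.absorb α) := by
  obtain ⟨s, rfl⟩ := p.profile_bijective.2 α
  exact measurable_of_tendsto_metrizable
    (fun t => p.measurable_op_pow_indicator t (p.measurableSet_nbhd 1 s.1))
    (tendsto_pi_nhds.2 fun x => p.tendsto_op_pow_indicator one_pos s x)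

/-- The law of the tremble of a trembling agent. -/
def trembleLaw (p : Params G) : Measure ℝ := volume[|Set.Icc (-p.ζ) p.ζ]

omit [Fintype ι] in
lemma volume_Icc_ne_zero (p : Params G) : volume (Set.Icc (-p.ζ) p.ζ) ≠ 0 := by
  rw [Real.volume_Icc, ne_eq, ENNReal.ofReal_eq_zero, not_le]
  linarith [p.ζ_pos]

instance (p : Params G) : IsProbabilityMeasure p.trembleLaw :=
  cond_isProbabilityMeasure_of_finite p.volume_Icc_ne_zero (by simp)

open Classical in
/-- The state after one step from the pure strategy state `s` in which agent `i` trembles by `t`.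
As no agent is dissatisfied at `s`, the actions do not change. -/
def tremble (p : Params G) (s : p.PureState) (i : ι) (t : ℝ) : p.State :=
  (s.profile, p.nextAspiration s.1 (Pi.single i t))

omit [Fintype ι] in
lemma measurable_nextAspiration (p : Params G) (x : p.State) : Measurable (p.nextAspiration x) :=
  measurable_pi_lambda _ fun i =>
    p.measurable_sat.comp (measurable_const.add (measurable_pi_apply i))

omit [Fintype ι] in
lemma measurable_single [DecidableEq ι] (i : ι) :
    Measurable fun t : ℝ => (Pi.single i t : ι → ℝ) :=
  measurable_pi_lambda _ fun j => by
    by_cases h : j = i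
    · subst h
      simpa using measurable_id'
    · simp [h]

omit [Fintype ι] in
lemma measurable_tremble (p : Params G) (s : p.PureState) (i : ι) :
    Measurable (p.tremble s i) := by
  classical
  exact measurable_const.prodMk ((p.measurable_nextAspiration s.1).comp (measurable_single i))

lemma stepProb_pure (p : Params G) (s : p.PureState) (α' : G.Profile) :
    p.stepProb s.1 α' = if α' = s.profile then 1 else 0 := by
  have h : ∀ i, G.u i s.1.1 - s.1.2 i = 0 := fun i => sub_eq_zero.2 (s.2 i).symm
  split_ifs with hα
  · subst hα
    refine Finset.prod_eq_one fun i _ => ?_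
    rw [PureState.profile, actionProb_self, h, φ_zero]
  · obtain ⟨i, hi⟩ := Function.ne_iff.1 hα
    refine Finset.prod_eq_zero (Finset.mem_univ i) ?_
    rw [p.actionProb_of_ne (x := s.1) hi, h, φ_zero, sub_self, zero_div]

lemma lintegral_Q (p : Params G) (s : p.PureState) {f : p.State → ℝ≥0∞} (hf : Measurable f) :
    ∫⁻ z, f z ∂p.Q s.1 =
      (Fintype.card ι : ℝ≥0∞)⁻¹ * ∑ i, ∫⁻ t, f (p.tremble s i t) ∂p.trembleLaw := by
  classical
  have hprob : IsProbabilityMeasure (volume[|Set.Icc (-p.ζ) p.ζ]) :=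
    inferInstanceAs (IsProbabilityMeasure p.trembleLaw)
  have hfin : SFinite p.singleTremble := by
    unfold singleTremble
    infer_instance
  have hstep : ∀ r, ∫⁻ z, f z ∂p.stepMeasure (s.1, r) =
      f (s.profile, p.nextAspiration s.1 r) := fun r => by
    rw [lintegral_stepMeasure p _ hf, Finset.sum_eq_single s.profile]
    · simp [stepProb_pure]
    · intro α' _ hα'
      simp [stepProb_pure, hα']
    · exact fun h => absurd (Finset.mem_univ _) h
  have hm : Measurable fun r : ι → ℝ => f (s.profile, p.nextAspiration s.1 r) :=
    hf.comp (measurable_const.prodMk (p.measurable_nextAspiration s.1))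
  rw [Q, lintegral_transition p _ _ hf]
  simp only [hstep]
  rw [singleTremble, lintegral_smul_measure, lintegral_finsetSum_measure, smul_eq_mul]
  congr 1
  refine Finset.sum_congr rfl fun i _ => ?_
  rw [lintegral_map hm]
  · rfl
  · exact measurable_single i

/-! ### The limit matrix -/

/-- The matrix `P̂`: the mean, over the trembling agent and its tremble, of the absorption
probabilities of the unperturbed process. -/
def limitMatrix (p : Params G) : Matrix p.PureState p.PureState ℝ := fun s s' =>
  (Fintype.card ι : ℝ)⁻¹ * ∑ i, ∫ t, p.absorb s'.profile (p.tremble s i t) ∂p.trembleLaw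

lemma P_pow_comp_Q_real (p : Params G) (t : ℕ) (s : p.PureState) {B : Set p.State}
    (hB : MeasurableSet B) :
    (((p.P ^ t) ∘ₖ p.Q) s.1).real B = (Fintype.card ι : ℝ)⁻¹ *
      ∑ i, ∫ r, (p.op ^ t) (B.indicator 1) (p.tremble s i r) ∂p.trembleLaw := by
  rw [Measure.real, Kernel.comp_apply' _ _ _ hB, lintegral_Q p s (Kernel.measurable_coe _ hB),
    ENNReal.toReal_mul, ENNReal.toReal_inv, ENNReal.toReal_natCast, ENNReal.toReal_sum]
  · congr 1
    refine Finset.sum_congr rfl fun i _ => ?_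
    rw [integral_eq_lintegral_of_nonneg_ae (Eventually.of_forall fun r => p.op_pow_indicator_nonneg t B _)
      ((p.measurable_op_pow_indicator t hB).comp (p.measurable_tremble s i)).aestronglyMeasurable]
    simp only [P_pow_apply p t _ hB]
  · intro i _
    refine ne_top_of_le_ne_top ENNReal.one_ne_top ?_
    calc ∫⁻ r, (p.P ^ t) (p.tremble s i r) B ∂p.trembleLaw ≤ ∫⁻ _, 1 ∂p.trembleLaw :=
          lintegral_mono fun r => by
            rw [P_pow_apply p t _ hB]
            exact ENNReal.ofReal_le_one.2 (p.op_pow_indicator_le_one t B _)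
      _ = 1 := by simp

theorem isLimitMatrix_limitMatrix (p : Params G) : p.IsLimitMatrix p.limitMatrix := by
  intro s s'
  filter_upwards [self_mem_nhdsWithin] with δ hδ
  have hB := p.measurableSet_nbhd δ s'.1
  simp only [P_pow_comp_Q_real p _ s hB]
  refine (tendsto_finsetSum _ fun i _ => ?_).const_mul _
  refine tendsto_integral_of_dominated_convergence (fun _ => 1) (fun t =>
    ((p.measurable_op_pow_indicator t hB).comp (p.measurable_tremble s i)).aestronglyMeasurable)
    (integrable_const _) (fun t => Eventually.of_forall fun r => ?_)
    (Eventually.of_forall fun r => p.tendsto_op_pow_indicator hδ s' _)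
  rw [Real.norm_of_nonneg (p.op_pow_indicator_nonneg t _ _)]
  exact p.op_pow_indicator_le_one t _ _

lemma IsLimitMatrix.unique {p : Params G} {M M' : Matrix p.PureState p.PureState ℝ}
    (h : p.IsLimitMatrix M) (h' : p.IsLimitMatrix M') : M = M' := by
  ext s s'
  obtain ⟨δ, h1, h2⟩ := ((h s s').and (h' s s')).exists
  exact tendsto_nhds_unique h1 h2

lemma integrable_absorb_tremble (p : Params G) (α : G.Profile) (s : p.PureState) (i : ι) :
    Integrable (fun t => p.absorb α (p.tremble s i t)) p.trembleLaw :=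
  (integrable_const 1).mono'
    ((p.measurable_absorb α).comp (p.measurable_tremble s i)).aestronglyMeasurable
    (Eventually.of_forall fun _ => by
      rw [Real.norm_of_nonneg (p.absorb_nonneg _ _)]
      exact p.absorb_le_one _ _)

lemma limitMatrix_mem_rowStochastic [Nonempty ι] (p : Params G) :
    p.limitMatrix ∈ Matrix.rowStochastic ℝ p.PureState := by
  rw [Matrix.mem_rowStochastic_iff_sum]
  refine ⟨fun s s' => mul_nonneg (by positivity) (Finset.sum_nonneg fun i _ =>
    integral_nonneg fun t => p.absorb_nonneg _ _), fun s => ?_⟩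
  simp only [limitMatrix, ← Finset.mul_sum]
  rw [Finset.sum_comm]
  have h : ∀ i, ∑ s' : p.PureState, ∫ t, p.absorb s'.profile (p.tremble s i t) ∂p.trembleLaw
      = 1 := fun i => by
    rw [← integral_finsetSum _ fun s' _ => p.integrable_absorb_tremble s'.profile s i]
    have : ∀ t, ∑ s' : p.PureState, p.absorb s'.profile (p.tremble s i t) = 1 := fun t => by
      rw [p.profile_bijective.sum_comp fun α => p.absorb α (p.tremble s i t), sum_absorb]
    simp [this]
  simp [h]

/-- A single tremble can make any one agent switch to any other action: a positive tremble makes it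
dissatisfied, and the new profile may then be kept forever. -/
lemma limitMatrix_pos (p : Params G) {s s' : p.PureState} {i : ι}
    (hi : s'.profile i ≠ s.profile i) (hne : ∀ k, k ≠ i → s'.profile k = s.profile k) :
    0 < p.limitMatrix s s' := by
  classical
  have : Nonempty ι := ⟨i⟩
  have hpos : ∀ t, 0 < t → 0 < p.absorb s'.profile (p.tremble s i t) := fun t ht => by
    refine p.absorb_pos (Finset.prod_pos fun k _ => ?_)
    have hasp : ((p.tremble s i t).2 k : ℝ) =
        p.sat (G.u k s.1.1 + (Pi.single i t : ι → ℝ) k) := by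
      simp only [tremble, nextAspiration, s.2, sub_self, mul_zero, add_zero]
    by_cases hk : k = i
    · subst hk
      have hlt : G.u k s.1.1 < (p.tremble s k t).2 k := by
        rw [hasp, Pi.single_eq_same, sat, Set.coe_projIcc]
        exact (lt_min (p.lt_hi k _) (by linarith)).trans_le (le_max_right _ _)
      rw [p.actionProb_of_ne (x := p.tremble s k t) hi]
      exact div_pos (sub_pos.2 (p.φ_lt_one (sub_neg.2 hlt))) (sub_pos.2 (one_lt_card G k))
    · rw [hne k hk]
      change 0 < p.actionProb (p.tremble s i t) k ((p.tremble s i t).1 k)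
      rw [actionProb_self]
      exact p.h_pos.trans_le (p.h_le_φ _)
  refine mul_pos (inv_pos.2 (Nat.cast_pos.2 Fintype.card_pos))
    (Finset.sum_pos' (fun j _ => integral_nonneg fun t => p.absorb_nonneg _ _)
      ⟨i, Finset.mem_univ i, ?_⟩)
  rw [integral_pos_iff_support_of_nonneg (fun t => p.absorb_nonneg _ _)
    (p.integrable_absorb_tremble _ s i)]
  refine lt_of_lt_of_le ?_ (measure_mono (s := Set.Ioc 0 p.ζ) fun t ht => (hpos t ht.1).ne')
  rw [trembleLaw, cond_apply measurableSet_Icc, Set.inter_eq_right.2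
    (Set.Ioc_subset_Icc_self.trans (Set.Icc_subset_Icc_left (by linarith [p.ζ_pos]))), Real.volume_Ioc, sub_zero]
  exact ENNReal.mul_pos (ENNReal.inv_ne_zero.2 (by simp))
    (ENNReal.ofReal_pos.2 p.ζ_pos).ne'

/-- `P̂` is irreducible, since any two profiles are joined by changes of single actions. -/
lemma eq_univ_of_closed (p : Params G) (S : Set p.PureState) (hS : S.Nonempty)
    (hcl : ∀ s ∈ S, ∀ s', 0 < p.limitMatrix s s' → s' ∈ S) : S = Set.univ := by
  classical
  obtain ⟨s, hs⟩ := hS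
  refine Set.eq_univ_of_forall fun s' => ?_
  have key : ∀ F : Finset ι, ∀ s'' : p.PureState,
      s''.profile = F.piecewise s'.profile s.profile → s'' ∈ S := by
    intro F
    induction F using Finset.induction_on with
    | empty =>
      intro s'' h
      rw [Finset.piecewise_empty] at h
      rwa [PureState.profile_injective p h]
    | insert i F _ ih =>
      intro s'' h
      obtain ⟨w, hw⟩ := p.profile_bijective.2 (F.piecewise s'.profile s.profile)
      by_cases heq : s''.profile i = w.profile i
      · refine ih s'' (funext fun k => ?_)
        by_cases hk : k = i
        · subst hk
          rw [heq, hw]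
        · rw [h, Finset.piecewise_insert_of_ne _ _ _ hk]
      · refine hcl w (ih w hw) s'' (p.limitMatrix_pos heq fun k hk => ?_)
        rw [h, hw, Finset.piecewise_insert_of_ne _ _ _ hk]
  exact key Finset.univ s' (Finset.piecewise_univ _ _).symm

lemma isInvariantDistribution_iff [Nonempty ι] (p : Params G) (π : p.PureState → ℝ) :
    p.IsInvariantDistribution π ↔
      π ∈ stdSimplex ℝ p.PureState ∧ π ᵥ* p.limitMatrix = π := by
  constructor
  · rintro ⟨M, hM, -, hπ, hπM⟩
    rw [hM.unique p.isLimitMatrix_limitMatrix] at hπM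
    exact ⟨hπ, hπM⟩
  · exact fun ⟨hπ, hπM⟩ => ⟨_, p.isLimitMatrix_limitMatrix, p.limitMatrix_mem_rowStochastic,
      hπ, hπM⟩

theorem existsUnique_isInvariantDistribution [Nonempty ι] (p : Params G) :
    ∃! π, p.IsInvariantDistribution π := by
  have hA : ∀ i, Nonempty {a // a ∈ G.A i} := fun i =>
    (Finset.card_pos.1 (two_pos.trans_le (G.two_le_card i))).to_subtype
  have : Nonempty p.PureState := (p.profile_bijective.2 fun i => (hA i).some).nonempty
  simp only [isInvariantDistribution_iff]
  exact existsUnique_invariant p.limitMatrix_mem_rowStochastic p.eq_univ_of_closed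

end Params

/-! ### Automorphisms of a game -/

namespace Game

variable {ι : Type u} {U : Type v}

/-- An automorphism of a game: a permutation of the agents together with the permutation of the
action profiles that hands the action of each agent `k` over to the agent `perm k`, such that
payoffs are handed over in the same way. -/
structure Automorphism (G : Game ι U) where
  /-- the permutation of the agents -/
  perm : Equiv.Perm ι
  /-- the induced permutation of the action profiles -/
  onProfile : Equiv.Perm G.Profile
  A_perm : ∀ k, G.A (perm k) = G.A k
  coe_onProfile : ∀ α k, (onProfile α (perm k) : U) = α k
  u_onProfile : ∀ α k, G.u (perm k) (onProfile α) = G.u k α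

/-- In a symmetric game all agents have the same actions: an action that `j` lacks could not be
handed over to `j`. The second action of `j` serves to make the two actions differ. -/
lemma IsSymmetric.A_eq {G : Game ι U} (hG : G.IsSymmetric) (i j : ι) : G.A i = G.A j := by
  classical
  suffices h : ∀ i j, G.A i ⊆ G.A j from (h i j).antisymm (h j i)
  intro i j a ha
  by_cases hij : i = j
  · exact hij ▸ ha
  have hA : ∀ k, Nonempty {a // a ∈ G.A k} := fun k =>
    (Finset.card_pos.1 (two_pos.trans_le (G.two_le_card k))).to_subtype
  obtain ⟨b, hb, hba⟩ := Finset.exists_mem_ne (G.two_le_card j) a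
  let α : G.Profile :=
    Function.update (Function.update (fun k => (hA k).some) j ⟨b, hb⟩) i ⟨a, ha⟩
  have hi : (α i : U) = a := by simp [α]
  have hj : (α j : U) = b := by simp [α, Ne.symm hij]
  obtain ⟨α', -, h, -⟩ := (hG i j α).2 (by rw [hi, hj]; exact hba.symm)
  rw [← hi, h.2.1]
  exact (α' j).2

open Classical in
/-- The action profile in which `i` and `j` have exchanged their actions. -/
def swapProfile (G : Game ι U) (hA : ∀ i j, G.A i = G.A j) (i j : ι) (α : G.Profile) : G.Profile :=
  fun k => ⟨α (Equiv.swap i j k), hA (Equiv.swap i j k) k ▸ (α (Equiv.swap i j k)).2⟩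

open Classical in
lemma coe_swapProfile_swap (G : Game ι U) (hA : ∀ i j, G.A i = G.A j) (i j : ι) (α : G.Profile)
    (k : ι) : (G.swapProfile hA i j α (Equiv.swap i j k) : U) = α k := by
  simp only [swapProfile]
  rw [Equiv.swap_apply_self]

lemma coe_swapProfile_left (G : Game ι U) (hA : ∀ i j, G.A i = G.A j) (i j : ι) (α : G.Profile) :
    (G.swapProfile hA i j α i : U) = α j := by
  classical
  simp only [swapProfile]
  rw [Equiv.swap_apply_left]

lemma coe_swapProfile_right (G : Game ι U) (hA : ∀ i j, G.A i = G.A j) (i j : ι)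
    (α : G.Profile) : (G.swapProfile hA i j α j : U) = α i := by
  classical
  simp only [swapProfile]
  rw [Equiv.swap_apply_right]

lemma swapProfile_of_ne (G : Game ι U) (hA : ∀ i j, G.A i = G.A j) (i j : ι) (α : G.Profile)
    {k : ι} (hi : k ≠ i) (hj : k ≠ j) : G.swapProfile hA i j α k = α k := by
  refine Subtype.ext ?_
  classical
  simp only [swapProfile]
  rw [Equiv.swap_apply_of_ne_of_ne hi hj]

lemma swapProfile_involutive (G : Game ι U) (hA : ∀ i j, G.A i = G.A j) (i j : ι) :
    Function.Involutive (G.swapProfile hA i j) := fun α =>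
  funext fun k => Subtype.ext (coe_swapProfile_swap G hA i j α k)

lemma IsSwap.eq_swapProfile {G : Game ι U} (hA : ∀ i j, G.A i = G.A j) {i j : ι}
    {α α' : G.Profile} (h : G.IsSwap i j α α') : α' = G.swapProfile hA i j α := by
  refine funext fun k => ?_
  by_cases hki : k = i
  · subst hki
    exact Subtype.ext (h.1.1.trans (G.coe_swapProfile_left hA k j α).symm)
  by_cases hkj : k = j
  · subst hkj
    exact Subtype.ext (h.1.2.1.symm.trans (G.coe_swapProfile_right hA i k α).symm)
  · rw [h.1.2.2 k hki hkj, G.swapProfile_of_ne hA i j α hki hkj]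

lemma swapProfile_eq_self {G : Game ι U} (hA : ∀ i j, G.A i = G.A j) {i j : ι} {α : G.Profile}
    (h : (α i : U) = α j) : G.swapProfile hA i j α = α := by
  refine funext fun k => ?_
  by_cases hki : k = i
  · subst hki
    exact Subtype.ext ((G.coe_swapProfile_left hA k j α).trans h.symm)
  by_cases hkj : k = j
  · subst hkj
    exact Subtype.ext ((G.coe_swapProfile_right hA i k α).trans h)
  · exact G.swapProfile_of_ne hA i j α hki hkj

open Classical in
/-- In a symmetric game, exchanging two agents is an automorphism. -/
def IsSymmetric.swap {G : Game ι U} (hG : G.IsSymmetric) (i j : ι) : G.Automorphism where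
  perm := Equiv.swap i j
  onProfile := (G.swapProfile_involutive hG.A_eq i j).toPerm
  A_perm _ := hG.A_eq _ _
  coe_onProfile α k := G.coe_swapProfile_swap hG.A_eq i j α k
  u_onProfile α k := by
    change G.u (Equiv.swap i j k) (G.swapProfile hG.A_eq i j α) = G.u k α
    by_cases h : (α i : U) = α j
    · have hu := (hG i j α).1 h
      rw [swapProfile_eq_self hG.A_eq h]
      by_cases hki : k = i
      · rw [hki, Equiv.swap_apply_left, hu]
      by_cases hkj : k = j
      · rw [hkj, Equiv.swap_apply_right, hu]
      · rw [Equiv.swap_apply_of_ne_of_ne hki hkj]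
    · obtain ⟨α', -, hα'⟩ := (hG i j α).2 h
      rw [← hα'.eq_swapProfile hG.A_eq]
      by_cases hki : k = i
      · rw [hki, Equiv.swap_apply_left, ← hα'.2.2.1]
      by_cases hkj : k = j
      · rw [hkj, Equiv.swap_apply_right, hα'.2.1]
      · rw [Equiv.swap_apply_of_ne_of_ne hki hkj, hα'.2.2.2 k hki hkj]

lemma succeeds_perm {G : Game ι ℝ} {e : Equiv.Perm ι} {α α' : G.Profile}
    (h : ∀ k, (α' (e k) : ℝ) = α k) (k : ι) : G.Succeeds α' (e k) ↔ G.Succeeds α k := by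
  simp only [Succeeds]
  rw [← e.forall_congr_right]
  simp only [h, ne_eq, e.injective.eq_iff]

/-- In a common-pool game, permuting the actions among the agents permutes the payoffs, since these
are expressed through the own action and through who succeeds. -/
lemma IsCommonPool.u_perm {G : Game ι ℝ} (hG : G.IsCommonPool) {e : Equiv.Perm ι}
    {α α' : G.Profile} (h : ∀ k, (α' (e k) : ℝ) = α k) (k : ι) : G.u (e k) α' = G.u k α := by
  obtain ⟨m, p, c, τ, -, -, hA, -, -, -, -, -, -, -, hu⟩ := hG
  obtain ⟨j, -, hj⟩ := Finset.mem_image.1 ((hA k).le (α k).2)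
  have hex : (∃ s, s ≠ e k ∧ G.Succeeds α' s) ↔ ∃ s, s ≠ k ∧ G.Succeeds α s := by
    rw [← e.exists_congr_right]
    simp only [succeeds_perm h, ne_eq, e.injective.eq_iff]
  rw [hu k α j hj.symm, hu (e k) α' j ((h k).trans hj.symm)]
  classical exact if_congr (succeeds_perm h k) rfl (if_congr hex rfl rfl)

lemma IsCommonPool.isSymmetric {G : Game ι ℝ} (hG : G.IsCommonPool) : G.IsSymmetric := by
  classical
  have hA : ∀ i j, G.A i = G.A j := by
    obtain ⟨m, p, c, τ, -, -, hA, -⟩ := hG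
    exact fun i j => (hA i).trans (hA j).symm
  intro i j α
  have hu := hG.u_perm (G.coe_swapProfile_swap hA i j α)
  constructor
  · intro h
    rw [swapProfile_eq_self hA h] at hu
    simpa using (hu i).symm
  · intro h
    refine ⟨G.swapProfile hA i j α, fun heq => h ?_,
      ⟨G.coe_swapProfile_left hA i j α, (G.coe_swapProfile_right hA i j α).symm,
        fun k => G.swapProfile_of_ne hA i j α⟩,
      by simpa using hu j, by simpa using (hu i).symm, fun k hki hkj => ?_⟩
    · rw [← G.coe_swapProfile_left hA i j α, heq]
    · simpa [Equiv.swap_apply_of_ne_of_ne hki hkj] using hu k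

end Game

/-! ### Invariance of `P̂` under automorphisms -/

namespace Params

variable {ι : Type u} {U : Type v} {G : Game ι U}

/-- The action of an automorphism on the states of the scheme. -/
def mapState (p : Params G) (g : G.Automorphism) (x : p.State) : p.State :=
  (g.onProfile x.1, fun k => x.2 (g.perm.symm k))

lemma mapState_snd (p : Params G) (g : G.Automorphism) (x : p.State) (k : ι) :
    (p.mapState g x).2 (g.perm k) = x.2 k := by
  simp [mapState]

lemma actionProb_mapState (p : Params G) (g : G.Automorphism) (x : p.State) (i : ι)
    (α' : G.Profile) :
    p.actionProb (p.mapState g x) (g.perm i) (g.onProfile α' (g.perm i)) =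
      p.actionProb x i (α' i) := by
  have h : g.onProfile α' (g.perm i) = (p.mapState g x).1 (g.perm i) ↔ α' i = x.1 i := by
    rw [← Subtype.coe_inj, ← Subtype.coe_inj, g.coe_onProfile]
    exact (g.coe_onProfile x.1 i).symm ▸ Iff.rfl
  have hu : G.u (g.perm i) (p.mapState g x).1 = G.u i x.1 := g.u_onProfile x.1 i
  simp only [actionProb, hu, mapState_snd, g.A_perm]
  classical exact if_congr h rfl rfl

lemma nextAspiration_mapState (p : Params G) (g : G.Automorphism) (x : p.State) (r : ι → ℝ) :
    p.nextAspiration (p.mapState g x) (fun k => r (g.perm.symm k)) =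
      fun k => p.nextAspiration x r (g.perm.symm k) := by
  funext k
  obtain ⟨k, rfl⟩ := g.perm.surjective k
  have hu : G.u (g.perm k) (p.mapState g x).1 = G.u k x.1 := g.u_onProfile x.1 k
  simp only [nextAspiration, hu, mapState_snd, Equiv.symm_apply_apply]

/-- The action of an automorphism on the pure strategy states. -/
def mapPure (p : Params G) (g : G.Automorphism) (s : p.PureState) : p.PureState :=
  ⟨p.mapState g s.1, fun k => by
    obtain ⟨k, rfl⟩ := g.perm.surjective k
    rw [mapState_snd, s.2]
    exact (g.u_onProfile s.1.1 k).symm⟩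

lemma profile_mapPure (p : Params G) (g : G.Automorphism) (s : p.PureState) :
    (p.mapPure g s).profile = g.onProfile s.profile := rfl

lemma tremble_mapPure (p : Params G) (g : G.Automorphism) (s : p.PureState) (i : ι) (t : ℝ) :
    p.tremble (p.mapPure g s) (g.perm i) t = p.mapState g (p.tremble s i t) := by
  classical
  refine Prod.ext rfl ?_
  have h : (Pi.single (g.perm i) t : ι → ℝ) = fun k => (Pi.single i t : ι → ℝ) (g.perm.symm k) := by
    funext k
    simp only [Pi.single_apply, Equiv.symm_apply_eq]
  have := p.nextAspiration_mapState g s.1 (Pi.single i t)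
  rw [← h] at this
  convert this using 1 <;> simp only [tremble, mapState, mapPure]

variable [Fintype ι]

lemma mapPure_bijective (p : Params G) (g : G.Automorphism) :
    Function.Bijective (p.mapPure g) :=
  Finite.injective_iff_bijective.1 fun _ _ h => PureState.profile_injective p
    (g.onProfile.injective (congrArg PureState.profile h))

lemma stepProb_mapState (p : Params G) (g : G.Automorphism) (x : p.State) (α' : G.Profile) :
    p.stepProb (p.mapState g x) (g.onProfile α') = p.stepProb x α' := by
  rw [stepProb, ← Equiv.prod_comp g.perm]
  exact Finset.prod_congr rfl fun i _ => p.actionProb_mapState g x i α'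

lemma op_mapState (p : Params G) (g : G.Automorphism) (f : p.State → ℝ) (x : p.State) :
    p.op f (p.mapState g x) = p.op (f ∘ p.mapState g) x := by
  rw [op_apply, op_apply, ← Equiv.sum_comp g.onProfile]
  refine Finset.sum_congr rfl fun α' _ => ?_
  have h : p.nextAspiration (p.mapState g x) 0 =
      fun k => p.nextAspiration x 0 (g.perm.symm k) := p.nextAspiration_mapState g x 0
  rw [stepProb_mapState, h]
  rfl

lemma op_pow_mapState (p : Params G) (g : G.Automorphism) (t : ℕ) (f : p.State → ℝ)
    (x : p.State) : (p.op ^ t) f (p.mapState g x) = (p.op ^ t) (f ∘ p.mapState g) x := by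
  induction t generalizing x with
  | zero => rfl
  | succ t ih =>
    rw [pow_succ', Module.End.mul_apply, Module.End.mul_apply, op_mapState]
    exact congrArg (p.op · x) (funext fun y => ih y)

lemma stayAt_mapState (p : Params G) (g : G.Automorphism) (α : G.Profile) :
    p.stayAt (g.onProfile α) ∘ p.mapState g = p.stayAt α := by
  funext x
  have hgap : p.gap (p.mapState g x) = p.gap x := by
    rw [gap, ← Equiv.sum_comp g.perm]
    refine Finset.sum_congr rfl fun k _ => ?_
    have hu : G.u (g.perm k) (p.mapState g x).1 = G.u k x.1 := g.u_onProfile x.1 k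
    rw [mapState_snd, hu]
  have hα : (p.mapState g x).1 = g.onProfile α ↔ x.1 = α := g.onProfile.injective.eq_iff
  simp only [Function.comp_apply, stayAt, hα, stay, hgap]

lemma absorb_mapState (p : Params G) (g : G.Automorphism) (α : G.Profile) (x : p.State) :
    p.absorb (g.onProfile α) (p.mapState g x) = p.absorb α x := by
  simp only [absorb, op_pow_mapState, stayAt_mapState]

lemma limitMatrix_mapPure (p : Params G) (g : G.Automorphism) (s s' : p.PureState) :
    p.limitMatrix (p.mapPure g s) (p.mapPure g s') = p.limitMatrix s s' := by
  rw [limitMatrix, ← Equiv.sum_comp g.perm]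
  simp only [tremble_mapPure, profile_mapPure, absorb_mapState]
  rfl

/-- The invariant distribution is unique, hence fixed by every automorphism. -/
lemma IsInvariantDistribution.mapPure_eq [Nonempty ι] {p : Params G} {π : p.PureState → ℝ}
    (hπ : p.IsInvariantDistribution π) (g : G.Automorphism) (s : p.PureState) :
    π (p.mapPure g s) = π s := by
  suffices h : p.IsInvariantDistribution (π ∘ p.mapPure g) from
    congrFun (p.existsUnique_isInvariantDistribution.unique h hπ) s
  rw [isInvariantDistribution_iff] at hπ ⊢
  refine ⟨⟨fun s => hπ.1.1 _, ((p.mapPure_bijective g).sum_comp π).trans hπ.1.2⟩,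
    funext fun s' => ?_⟩
  refine Eq.trans ?_ (congrFun hπ.2 (p.mapPure g s'))
  simp only [Matrix.vecMul, dotProduct, Function.comp_apply]
  rw [← (p.mapPure_bijective g).sum_comp fun s => π s * p.limitMatrix s (p.mapPure g s')]
  simp only [limitMatrix_mapPure]

lemma IsInvariantDistribution.eq_of_equivalent [Nonempty ι] {p : Params G} (hG : G.IsSymmetric)
    {π : p.PureState → ℝ} (hπ : p.IsInvariantDistribution π) {s s' : p.PureState}
    (h : p.Equivalent s s') : π s = π s' := by
  obtain ⟨-, i, j, -, hswap⟩ := h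
  have : p.mapPure (hG.swap i j) s = s' :=
    PureState.profile_injective p (hswap.eq_swapProfile hG.A_eq).symm
  rw [← this, hπ.mapPure_eq]

lemma IsInvariantDistribution.successMass_eq [Nonempty ι] {G : Game ι ℝ} {p : Params G}
    (hG : G.IsSymmetric) {π : p.PureState → ℝ} (hπ : p.IsInvariantDistribution π) (i j : ι) :
    p.successMass π i = p.successMass π j := by
  classical
  let g := hG.swap i j
  have hg : g.perm i = j := Equiv.swap_apply_left i j
  simp only [successMass, Finset.sum_filter]
  rw [← (p.mapPure_bijective g).sum_comp fun s => if G.Succeeds s.profile j then π s else 0]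
  refine Finset.sum_congr rfl fun s _ => ?_
  have hs : G.Succeeds (p.mapPure g s).profile j ↔ G.Succeeds s.profile i := by
    rw [← hg]
    exact Game.succeeds_perm (g.coe_onProfile s.profile) i
  simp only [hs, hπ.mapPure_eq]

end Params

end AspirationLearning

theorem lemma5p2 {ι : Type u} [Fintype ι] [Nonempty ι] :
    (∀ (U : Type v) (G : AspirationLearning.Game ι U) (p : AspirationLearning.Params G),
      G.IsSymmetric →
        (∃! π, p.IsInvariantDistribution π) ∧
        ∀ π, p.IsInvariantDistribution π →
          ∀ s s' : p.PureState, p.Equivalent s s' → π s = π s') ∧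
    (∀ (G : AspirationLearning.Game ι ℝ) (p : AspirationLearning.Params G),
      G.IsCommonPool →
        (∃! π, p.IsInvariantDistribution π) ∧
        ∀ π, p.IsInvariantDistribution π →
          ∀ i j : ι, p.successMass π i = p.successMass π j) :=
  ⟨fun _ _ p hG => ⟨p.existsUnique_isInvariantDistribution,
      fun _ hπ _ _ h => hπ.eq_of_equivalent hG h⟩,
    fun _ p hG => ⟨p.existsUnique_isInvariantDistribution,
      fun _ hπ i j => hπ.successMass_eq hG.isSymmetric i j⟩⟩
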